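/- Let $m_1,m_2,m_3,\dots$ be integers with $m_i\ge 2$, let $Y_i=\{1,\dots,m_i\}$, and let $\mathcal T$ be the rooted tree of all finite words $y_1\cdots y_n$ with $y_i\in Y_i$, ordered by the prefix relation; an automorphism of $\mathcal T$ is a permutation of the words that preserves the prefix order. Let $A_\omega$ be a subgroup of $\mathrm{Sym}(Y_1)$, acting on $\mathcal T$ by permuting the first letters of words, let $B$ be a finite group, and let $\omega_{i,j}:B\to \mathrm{Sym}(Y_{i+1})$ ($i\ge 1$, $1\le j\le m_i-1$) be group homomorphisms. For $b\in B$ let $b_\omega$ be the automorphism of $\mathcal T$ whose vertex permutation at the vertex $m_1m_2\cdots m_{i-1}j$ is $\omega_{i,j}(b)$ for all $i\ge 1$ and $1\le j\le m_i-1$, and whose other vertex permutations are trivial. Put $G_\omega=\langle A_\omega\cup\{b_\omega : b\in B\}\rangle\le \mathrm{Aut}(\mathcal T)$. Suppose that $G_\omega$ is a GG group with directed part $B$, that is: 1. (spherical transitivity) $A_\omega$ acts transitively on $Y_1$, and for every $r\ge 1$ the subgroup of $\mathrm{Sym}(Y_{r+1})$ generated by $\bigcup_{j=1}^{m_r-1}\omega_{r,j}(B)$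 acts transitively on $Y_{r+1}$; 2. (strong kernel intersection) $\bigcap_{i\ge r}\bigcap_{j=1}^{m_i-1}\ker\omega_{i,j}=1$ for all $r\ge 1$; 3. $\omega_{i,j}$ is trivial whenever $j\ne 1$; 4. (strong covering) $\bigcup_{i\ge r}\ker\omega_{i,1}=B$ for all $r\ge 1$. Then $G_\omega$ has subexponential word growth. That is, $G_\omega$ is finitely generated, and for every finite set $S$ that generates $G_\omega$ as a monoid, the function $\gamma(n)$ that counts the elements of $G_\omega$ expressible as a product of at most $n$ elements of $S$ satisfies $\gamma(n)\precsim e^n$ but not $e^n\precsim\gamma(n)$, where $f\precsim g$ means that there is a constant $C\in\mathbb N$ with $f(n)\le g(Cn)$ for all $n\in\mathbb N$. -/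

import Mathlib

/-- A sequence of branching indices. The index `m i` is `m_{i+1}` in one-based notation, and
`{1, …, m_{i+1}}` is modelled by `Fin (m i)`. -/
structure BranchingSeq where
  idx : ℕ → ℕ
  two_le : ∀ i, 2 ≤ idx i

namespace BranchingSeq

/-- The alphabet used at (zero-based) position `i` of a word. -/
abbrev Letter (m : BranchingSeq) (i : ℕ) : Type := Fin (m.idx i)

/-- The first letter `1` of the alphabet at position `i`. -/
def first (m : BranchingSeq) (i : ℕ) : m.Letter i :=
  ⟨0, lt_of_lt_of_le Nat.zero_lt_two (m.two_le i)⟩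

/-- The last letter `m_{i+1}` of the alphabet at position `i`. -/
def last (m : BranchingSeq) (i : ℕ) : m.Letter i :=
  ⟨m.idx i - 1, Nat.sub_lt (lt_of_lt_of_le Nat.zero_lt_two (m.two_le i)) Nat.zero_lt_one⟩

theorem first_ne_last (m : BranchingSeq) (i : ℕ) : m.first i ≠ m.last i := by
  intro h
  have h1 := congrArg Fin.val h
  have h2 := m.two_le i
  simp only [first, last] at h1
  omega

/-- The letters other than the last one, indexing the homomorphisms `ω_{i+1,j}`. -/
abbrev NonLast (m : BranchingSeq) (i : ℕ) : Type := {y : m.Letter i // y ≠ m.last i}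

/-- The first letter, as an index of a homomorphism. -/
def firstIdx (m : BranchingSeq) (i : ℕ) : m.NonLast i := ⟨m.first i, m.first_ne_last i⟩

/-- The shifted sequence `m_2, m_3, …`. -/
abbrev shift (m : BranchingSeq) : BranchingSeq := ⟨fun i => m.idx (i + 1), fun i => m.two_le (i + 1)⟩

end BranchingSeq

/-- Finite words `y_1 y_2 … y_n` with `y_i` in the `i`-th alphabet: the vertices of the
spherically homogeneous rooted tree with branching indices `m`. -/
inductive TreeWord : BranchingSeq → Type
  | nil {m : BranchingSeq} : TreeWord m
  | cons {m : BranchingSeq} (y : m.Letter 0) (w : TreeWord m.shift) : TreeWord m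

namespace TreeWord

/-- The prefix relation. -/
inductive IsPrefix : {m : BranchingSeq} → TreeWord m → TreeWord m → Prop
  | nil {m : BranchingSeq} (w : TreeWord m) : IsPrefix nil w
  | cons {m : BranchingSeq} (y : m.Letter 0) {u v : TreeWord m.shift} (h : IsPrefix u v) :
      IsPrefix (cons y u) (cons y v)

theorem isPrefix_refl {m : BranchingSeq} (u : TreeWord m) : IsPrefix u u := by
  induction u with
  | nil => exact .nil _
  | cons y w ih => exact .cons y ih

theorem isPrefix_cons_iff {m : BranchingSeq} (y z : m.Letter 0) (u v : TreeWord m.shift) :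
    IsPrefix (cons y u) (cons z v) ↔ y = z ∧ IsPrefix u v := by
  constructor
  · intro h
    cases h with
    | cons _ h => exact ⟨rfl, h⟩
  · rintro ⟨rfl, h⟩
    exact .cons y h

theorem not_isPrefix_cons_nil {m : BranchingSeq} (y : m.Letter 0) (u : TreeWord m.shift) :
    ¬ IsPrefix (cons y u) nil := by
  intro h
  cases h

theorem isPrefix_trans {m : BranchingSeq} {u v w : TreeWord m} (h1 : IsPrefix u v)
    (h2 : IsPrefix v w) : IsPrefix u w := by
  induction h1 with
  | nil => exact .nil _
  | cons y h ih =>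
    cases h2 with
    | cons _ h2 => exact .cons y (ih h2)

theorem isPrefix_antisymm {m : BranchingSeq} {u v : TreeWord m} (h1 : IsPrefix u v)
    (h2 : IsPrefix v u) : u = v := by
  induction h1 with
  | nil w =>
    cases h2
    rfl
  | cons y h ih =>
    cases h2 with
    | cons _ h2 => rw [ih h2]

instance (m : BranchingSeq) : PartialOrder (TreeWord m) where
  le := IsPrefix
  le_refl := isPrefix_refl
  le_trans _ _ _ := isPrefix_trans
  le_antisymm _ _ := isPrefix_antisymm

end TreeWord

/-- Automorphisms of the rooted tree: permutations of the words preserving the prefix order. -/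
abbrev TreeAut (m : BranchingSeq) : Type := TreeWord m ≃o TreeWord m

/-- The action of a permutation of the first alphabet on the first letter of a word. -/
def rootedMap {m : BranchingSeq} (a : Equiv.Perm (m.Letter 0)) : TreeWord m → TreeWord m
  | .nil => .nil
  | .cons y w => .cons (a y) w

theorem rootedMap_rootedMap {m : BranchingSeq} (a c : Equiv.Perm (m.Letter 0)) (u : TreeWord m) :
    rootedMap a (rootedMap c u) = rootedMap (a * c) u := by
  cases u <;> rfl

theorem rootedMap_one {m : BranchingSeq} (u : TreeWord m) :
    rootedMap (1 : Equiv.Perm (m.Letter 0)) u = u := by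
  cases u <;> rfl

theorem rootedMap_isPrefix {m : BranchingSeq} (a : Equiv.Perm (m.Letter 0)) (u v : TreeWord m) :
    (rootedMap a u).IsPrefix (rootedMap a v) ↔ u.IsPrefix v := by
  cases u with
  | nil => exact ⟨fun _ => .nil _, fun _ => .nil _⟩
  | cons y u =>
    cases v with
    | nil =>
      exact ⟨fun h => absurd h (TreeWord.not_isPrefix_cons_nil _ _),
        fun h => absurd h (TreeWord.not_isPrefix_cons_nil _ _)⟩
    | cons z v =>
      simp only [rootedMap, TreeWord.isPrefix_cons_iff, EmbeddingLike.apply_eq_iff_eq]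

/-- The rooted automorphism with root permutation `a`. -/
def rootedAut {m : BranchingSeq} (a : Equiv.Perm (m.Letter 0)) : TreeAut m where
  toFun := rootedMap a
  invFun := rootedMap a⁻¹
  left_inv u := by rw [rootedMap_rootedMap, inv_mul_cancel, rootedMap_one]
  right_inv u := by rw [rootedMap_rootedMap, mul_inv_cancel, rootedMap_one]
  map_rel_iff' := by
    intro u v
    exact rootedMap_isPrefix a u v

/-- A doubly indexed family of homomorphisms; `hom i j` is `ω_{i+1,j} : B → Sym(Y_{i+2})`. -/
abbrev HomFamily (m : BranchingSeq) (B : Type*) [Group B] :=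
  ∀ i : ℕ, m.NonLast i → B →* Equiv.Perm (m.Letter (i + 1))

/-- The shifted family. -/
def HomFamily.shift {m : BranchingSeq} {B : Type*} [Group B] (hom : HomFamily m B) :
    HomFamily m.shift B :=
  fun i j => hom (i + 1) j

/-- The action of `b` along the rightmost ray: the section at the letter `j`, not the last
one, is the rooted automorphism `ω_{1,j}(b)`, the section at the last letter is the directed
automorphism of `b` for the shifted family, and the root permutation is trivial. So the vertex
permutation at `m_1 … m_{n-1} j` with `j ≠ m_n` is `ω_{n,j}(b)`, all others are trivial. -/
def directedMap {B : Type*} [Group B] (b : B) :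
    {m : BranchingSeq} → HomFamily m B → TreeWord m → TreeWord m
  | _, _, .nil => .nil
  | m, hom, .cons y w =>
    if h : y = m.last 0 then .cons y (directedMap b hom.shift w)
    else .cons y (rootedMap (m := m.shift) (hom 0 ⟨y, h⟩ b) w)

theorem directedMap_directedMap {B : Type*} [Group B] (b c : B) {m : BranchingSeq}
    (hom : HomFamily m B) (u : TreeWord m) :
    directedMap b hom (directedMap c hom u) = directedMap (b * c) hom u := by
  induction u with
  | nil => rfl
  | @cons m y w ih =>
    by_cases h : y = m.last 0
    · simp only [directedMap, h, dif_pos, ih]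
    · simp only [directedMap, h, dif_neg, not_false_eq_true, rootedMap_rootedMap, map_mul]

theorem directedMap_one {B : Type*} [Group B] {m : BranchingSeq} (hom : HomFamily m B)
    (u : TreeWord m) : directedMap (1 : B) hom u = u := by
  induction u with
  | nil => rfl
  | @cons m y w ih =>
    by_cases h : y = m.last 0
    · simp only [directedMap, h, dif_pos, ih]
    · simp only [directedMap, h, dif_neg, not_false_eq_true, map_one]
      rw [rootedMap_one]

theorem directedMap_isPrefix {B : Type*} [Group B] (b : B) {m : BranchingSeq}
    (hom : HomFamily m B) (u v : TreeWord m) (h : u.IsPrefix v) :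
    (directedMap b hom u).IsPrefix (directedMap b hom v) := by
  induction h with
  | nil => exact .nil _
  | @cons m y u v h ih =>
    by_cases hy : y = m.last 0
    · simp only [directedMap, hy, dif_pos]
      exact .cons _ (ih _)
    · simp only [directedMap, hy, dif_neg, not_false_eq_true]
      exact .cons _ ((rootedMap_isPrefix _ _ _).2 h)

/-- The directed automorphism `b_ω`. -/
def directedAut {m : BranchingSeq} {B : Type*} [Group B] (hom : HomFamily m B) (b : B) :
    TreeAut m where
  toFun := directedMap b hom
  invFun := directedMap b⁻¹ hom
  left_inv u := by rw [directedMap_directedMap, inv_mul_cancel, directedMap_one]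
  right_inv u := by rw [directedMap_directedMap, mul_inv_cancel, directedMap_one]
  map_rel_iff' := by
    intro u v
    constructor
    · intro h
      have h' := directedMap_isPrefix b⁻¹ hom _ _ h
      simp only [Equiv.coe_fn_mk, directedMap_directedMap, inv_mul_cancel, directedMap_one] at h'
      exact h'
    · exact directedMap_isPrefix b hom u v

/-- A defining triple `ω = (A_ω, B, (ω_{i,j}))`. -/
structure DefiningTriple (m : BranchingSeq) (B : Type*) [Group B] where
  /-- the group of rooted automorphisms, given by their root permutations -/
  rootPart : Subgroup (Equiv.Perm (m.Letter 0))
  hom : HomFamily m B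

namespace DefiningTriple

variable {m : BranchingSeq} {B : Type*} [Group B]

/-- The group `G_ω = ⟨A_ω ∪ B_ω⟩` of tree automorphisms. -/
def group (ω : DefiningTriple m B) : Subgroup (TreeAut m) :=
  Subgroup.closure (rootedAut '' (ω.rootPart : Set (Equiv.Perm (m.Letter 0))) ∪
    Set.range (directedAut ω.hom))

/-- The root group `A_{σ^r ω}` of the `r`-th shifted triple: `A_ω` for `r = 0`, and the group
generated by the images of `ω_{r,j}`, `1 ≤ j < m_r`, for `r ≥ 1`. -/
def shiftedRootPart (ω : DefiningTriple m B) : (r : ℕ) → Subgroup (Equiv.Perm (m.Letter r))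
  | 0 => ω.rootPart
  | r + 1 => ⨆ j : m.NonLast r, (ω.hom r j).range

/-- `ω` defines a spinal group. -/
structure IsSpinal (ω : DefiningTriple m B) : Prop where
  spherically_transitive : ∀ (r : ℕ) (x y : m.Letter r), ∃ a ∈ ω.shiftedRootPart r, a x = y
  strong_kernel_intersection : ∀ r : ℕ, (⨅ i ≥ r, ⨅ j : m.NonLast i, (ω.hom i j).ker) = ⊥

/-- `ω` defines a GG group: it is spinal, `ω_{i,j}` is trivial for `j ≠ 1`, and the kernels
`K_i` of `ω_i = ω_{i,1}` satisfy the strong covering condition. -/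
structure IsGG (ω : DefiningTriple m B) : Prop extends ω.IsSpinal where
  hom_eq_one : ∀ (i : ℕ) (j : m.NonLast i), j ≠ m.firstIdx i → ω.hom i j = 1
  strong_covering : 
    ∀ r : ℕ, (⋃ i ≥ r, ((ω.hom i (m.firstIdx i)).ker : Set B)) = Set.univ

end DefiningTriple

/-- The ball of radius `n`: the elements represented by words of length at most `n` over `S`. -/
def wordBall {G : Type*} [Group G] (S : Set G) (n : ℕ) : Set G :=
  {g | ∃ l : List G, (∀ s ∈ l, s ∈ S) ∧ l.length ≤ n ∧ l.prod = g}

/-- The word growth function of `G` with respect to `S` (used for finite `S` only). -/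
noncomputable def wordGrowth {G : Type*} [Group G] (S : Set G) (n : ℕ) : ℕ :=
  (wordBall S n).ncard

/-- The relation `f ≾ g`. -/
def GrowthLE (f g : ℕ → ℝ) : Prop := ∃ C : ℕ, ∀ n : ℕ, f n ≤ g (C * n)

/-- `G` is finitely generated and, for every finite subset `S` generating `G` as a monoid, the
word growth function satisfies `γ ≾ e^n` and not `e^n ≾ γ`. -/
def HasSubexponentialGrowth (G : Type*) [Group G] : Prop :=
  Group.FG G ∧ ∀ S : Set G, S.Finite → Submonoid.closure S = ⊤ →
    GrowthLE (fun n => (wordGrowth S n : ℝ)) (fun n => Real.exp n) ∧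
    ¬ GrowthLE (fun n => Real.exp n) (fun n => (wordGrowth S n : ℝ))

/-! Represent group elements by words in rooted and directed letters, and let the norm of `g` be the
least number of directed letters needed. It suffices that the series `∑ exp (-t * norm g)` converges
for every `t > 0`: balls then grow at most like a constant times `exp (t * D * n)`, with `D`
depending only on the generating set.

For large `t` the series converges by crude counting, with a threshold depending only on `|B|` and a
bound on the root group. The rest lowers `t` by contraction. Since an element is determined by its
root permutation and its sections, an inequality between its norm and those of its sections
transfers convergence from the shifted triple. In a word `w`, each directed letter `c` survives in
exactly one section and leaves a nontrivial rooted letter in at most one other, in none if `c` lies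
in the kernel at that level. After merging adjacent directed letters, the norm of a section is
bounded both by its number of directed letters and by its number of nontrivial rooted letters plus
one; twice the norm is bounded by the sum. So if `b` dies on the first level, twice the total norm
of the sections is at most the `favor b` weight of `w` (`b` counts 1, other letters count 2) plus
the constant `m.idx 0` (`NormSummable.favor_of_shift`). If `b` dies only on a later level, which
covering guarantees, one first descends without loss (`NormSummable.of_shift`).

With `N = |B|`, the `favor b` weights of a word average to `(2N-1)/N < 2` times its number of
directed letters, so every `g` is cheap for some `b`. Hence convergence at `2N/(2N-1) * t` for all
triples with the same bound implies convergence at `t` (`NormSummable.of_favor`), and iteration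
reaches every `t > 0`. -/

/-! ### Words in the generators and their weights. -/

/-- Words over rooted and directed generators. -/
abbrev SpinalWord (m : BranchingSeq) (B : Type*) : Type _ := List (Equiv.Perm (m.Letter 0) ⊕ B)

namespace SpinalWord

variable {m : BranchingSeq} {B : Type*}

/-- The weighted number of directed letters of a word. -/
def weight (f : B → ℕ) (w : SpinalWord m B) : ℕ := (w.map (Sum.elim (fun _ => 0) f)).sum

@[simp] theorem weight_nil (f : B → ℕ) : weight f ([] : SpinalWord m B) = 0 := rfl

@[simp] theorem weight_cons_inl (f : B → ℕ) (a : Equiv.Perm (m.Letter 0)) (w : SpinalWord m B) :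
    weight f (Sum.inl a :: w) = weight f w := by simp [weight]

@[simp] theorem weight_cons_inr (f : B → ℕ) (b : B) (w : SpinalWord m B) :
    weight f (Sum.inr b :: w) = f b + weight f w := by simp [weight]

@[simp] theorem weight_append (f : B → ℕ) (v w : SpinalWord m B) :
    weight f (v ++ w) = weight f v + weight f w := by simp [weight]

open Classical in
/-- The number of nontrivial rooted letters of a word. -/
def rootCount (w : SpinalWord m B) : ℕ :=
  (w.map (Sum.elim (fun a => if a = 1 then 0 else 1) (fun _ => 0))).sum

@[simp] theorem rootCount_nil : rootCount ([] : SpinalWord m B) = 0 := rfl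

open Classical in
@[simp] theorem rootCount_cons_inl (a : Equiv.Perm (m.Letter 0)) (w : SpinalWord m B) :
    rootCount (Sum.inl a :: w) = (if a = 1 then 0 else 1) + rootCount w := by simp [rootCount]

@[simp] theorem rootCount_cons_inr (b : B) (w : SpinalWord m B) :
    rootCount (Sum.inr b :: w) = rootCount w := by simp [rootCount]

/-- The rooted letters of the word lie in `A`. -/
def Admissible (A : Subgroup (Equiv.Perm (m.Letter 0))) (w : SpinalWord m B) : Prop :=
  ∀ a, Sum.inl a ∈ w → a ∈ A

variable {A : Subgroup (Equiv.Perm (m.Letter 0))}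

theorem admissible_nil : Admissible A ([] : SpinalWord m B) := by simp [Admissible]

@[simp] theorem admissible_cons_inl {a : Equiv.Perm (m.Letter 0)} {w : SpinalWord m B} :
    Admissible A (Sum.inl a :: w) ↔ a ∈ A ∧ Admissible A w := by
  simp [Admissible]

@[simp] theorem admissible_cons_inr {b : B} {w : SpinalWord m B} :
    Admissible A (Sum.inr b :: w) ↔ Admissible A w := by
  simp [Admissible]

theorem Admissible.append {v w : SpinalWord m B} (hv : Admissible A v) (hw : Admissible A w) :
    Admissible A (v ++ w) := by
  intro a ha
  rcases List.mem_append.1 ha with h | h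
  · exact hv a h
  · exact hw a h

variable [Group B]

/-- The tree automorphism represented by a word. -/
def toAut (hom : HomFamily m B) (w : SpinalWord m B) : TreeAut m :=
  (w.map (Sum.elim rootedAut (directedAut hom))).prod

@[simp] theorem toAut_nil (hom : HomFamily m B) : toAut hom ([] : SpinalWord m B) = 1 := rfl

@[simp] theorem toAut_cons_inl (hom : HomFamily m B) (a : Equiv.Perm (m.Letter 0))
    (w : SpinalWord m B) : toAut hom (Sum.inl a :: w) = rootedAut a * toAut hom w := by
  simp [toAut]

@[simp] theorem toAut_cons_inr (hom : HomFamily m B) (b : B) (w : SpinalWord m B) :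
    toAut hom (Sum.inr b :: w) = directedAut hom b * toAut hom w := by
  simp [toAut]

@[simp] theorem toAut_append (hom : HomFamily m B) (v w : SpinalWord m B) :
    toAut hom (v ++ w) = toAut hom v * toAut hom w := by
  simp [toAut]

end SpinalWord

section Generators

variable {m : BranchingSeq} {B : Type*} [Group B]

theorem rootedAut_mul (a c : Equiv.Perm (m.Letter 0)) :
    rootedAut (a * c) = rootedAut a * rootedAut c := by
  ext u
  exact (rootedMap_rootedMap a c u).symm

theorem rootedAut_one : rootedAut (1 : Equiv.Perm (m.Letter 0)) = 1 := by
  ext u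
  exact rootedMap_one u

theorem directedAut_mul (hom : HomFamily m B) (b c : B) :
    directedAut hom (b * c) = directedAut hom b * directedAut hom c := by
  ext u
  exact (directedMap_directedMap b c hom u).symm

theorem directedAut_one (hom : HomFamily m B) : directedAut hom (1 : B) = 1 := by
  ext u
  exact directedMap_one hom u

theorem rootedAut_inv (a : Equiv.Perm (m.Letter 0)) : (rootedAut a)⁻¹ = rootedAut a⁻¹ := by
  rw [inv_eq_iff_mul_eq_one, ← rootedAut_mul, mul_inv_cancel, rootedAut_one]

theorem directedAut_inv (hom : HomFamily m B) (b : B) :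
    (directedAut hom b)⁻¹ = directedAut hom b⁻¹ := by
  rw [inv_eq_iff_mul_eq_one, ← directedAut_mul, mul_inv_cancel, directedAut_one]

end Generators

/-! ### Sections of words and the contraction count. -/

/-- `g` acts on first letters by `σ`, and its section at the letter `y` is `h y`. -/
def TreeAut.HasSections {m : BranchingSeq} (g : TreeAut m) (σ : Equiv.Perm (m.Letter 0))
    (h : m.Letter 0 → TreeAut m.shift) : Prop :=
  ∀ y w, g (.cons y w) = .cons (σ y) (h y w)

theorem TreeAut.map_nil {m : BranchingSeq} (g : TreeAut m) : g .nil = .nil := by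
  have h1 : g .nil ≤ g (g.symm .nil) := g.monotone (TreeWord.IsPrefix.nil _)
  rw [OrderIso.apply_symm_apply] at h1
  exact le_antisymm h1 (TreeWord.IsPrefix.nil _)

theorem TreeAut.HasSections.ext {m : BranchingSeq} {g g' : TreeAut m}
    {σ : Equiv.Perm (m.Letter 0)} {h : m.Letter 0 → TreeAut m.shift}
    (hg : g.HasSections σ h) (hg' : g'.HasSections σ h) : g = g' := by
  apply RelIso.ext
  intro u
  cases u with
  | nil => exact (TreeAut.map_nil g).trans (TreeAut.map_nil g').symm
  | cons y w => exact (hg y w).trans (hg' y w).symm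

namespace SpinalWord

variable {m : BranchingSeq} {B : Type*} [Group B]

/-- The permutation of the first letters induced by a word. -/
def rootPerm : SpinalWord m B → Equiv.Perm (m.Letter 0)
  | [] => 1
  | Sum.inl a :: w => a * rootPerm w
  | Sum.inr _ :: w => rootPerm w

open Classical in
/-- A word representing the section at the letter `y`. -/
noncomputable def sectionWord (hom : HomFamily m B) (y : m.Letter 0) :
    SpinalWord m B → SpinalWord m.shift B
  | [] => []
  | Sum.inl _ :: w => sectionWord hom y w
  | Sum.inr b :: w =>
    if h : rootPerm w y = m.last 0 then Sum.inr b :: sectionWord hom y w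
    else Sum.inl (hom 0 ⟨rootPerm w y, h⟩ b) :: sectionWord hom y w

theorem hasSections_toAut (hom : HomFamily m B) (w : SpinalWord m B) :
    (toAut hom w).HasSections (rootPerm w) (fun y => toAut hom.shift (sectionWord hom y w)) := by
  induction w with
  | nil => intro y u; rfl
  | cons x w ih =>
    intro y u
    rcases x with a | b
    · rw [toAut_cons_inl, RelIso.mul_apply, ih]
      rfl
    · rw [toAut_cons_inr, RelIso.mul_apply, ih]
      by_cases h : rootPerm w y = m.last 0
      · simp only [sectionWord, rootPerm, h, dif_pos, toAut_cons_inr, RelIso.mul_apply]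
        simp [directedAut, directedMap]
      · simp only [sectionWord, rootPerm, h, dif_neg, not_false_eq_true, toAut_cons_inl,
          RelIso.mul_apply]
        simp [directedAut, directedMap, h, rootedAut]

/-- A directed letter stays directed only in the section at the one letter `y` that the suffix to
its right moves to the last letter. -/
theorem sum_weight_sectionWord (hom : HomFamily m B) (f : B → ℕ) (w : SpinalWord m B) :
    ∑ y, weight f (sectionWord hom y w) = weight f w := by
  classical
  induction w with
  | nil => simp [sectionWord]
  | cons x w ih =>
    rcases x with a | b
    · simpa [sectionWord] using ih
    · have key : ∀ y, weight f (sectionWord hom y (Sum.inr b :: w)) =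
          (if rootPerm w y = m.last 0 then f b else 0) + weight f (sectionWord hom y w) := by
        intro y
        by_cases h : rootPerm w y = m.last 0 <;> simp [sectionWord, h]
      simp only [key, Finset.sum_add_distrib, ih, weight_cons_inr]
      rw [Equiv.sum_comp (rootPerm w) (fun y => if y = m.last 0 then f b else 0)]
      simp

/-- A directed letter `b` contributes a nontrivial rooted letter only at the one `y` moved to the
first letter, and only if its image there is nontrivial. Thus `f` may vanish on the kernel, which is
the source of the saving. -/
theorem sum_rootCount_sectionWord_le (hom : HomFamily m B)
    (htriv : ∀ j, j ≠ m.firstIdx 0 → hom 0 j = 1) (f : B → ℕ)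
    (hf : ∀ b, hom 0 (m.firstIdx 0) b ≠ 1 → 1 ≤ f b) (w : SpinalWord m B) :
    ∑ y, rootCount (sectionWord hom y w) ≤ weight f w := by
  classical
  induction w with
  | nil => simp [sectionWord]
  | cons x w ih =>
    rcases x with a | b
    · simpa [sectionWord] using ih
    · have key : ∀ y, rootCount (sectionWord hom y (Sum.inr b :: w)) ≤
          (if rootPerm w y = m.first 0 then f b else 0) + rootCount (sectionWord hom y w) := by
        intro y
        by_cases h : rootPerm w y = m.last 0
        · simp [sectionWord, h]
        · by_cases h' : rootPerm w y = m.first 0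
          · have e : (⟨rootPerm w y, h⟩ : m.NonLast 0) = m.firstIdx 0 := Subtype.ext h'
            by_cases h1 : hom 0 (m.firstIdx 0) b = 1
            · simp [sectionWord, h, e, h1]
            · have := hf b h1
              rw [if_pos h']
              simpa [sectionWord, h, e, h1] using this
          · have e : (⟨rootPerm w y, h⟩ : m.NonLast 0) ≠ m.firstIdx 0 :=
              fun e => h' (congrArg Subtype.val e)
            simp [sectionWord, h, htriv _ e]
      refine (Finset.sum_le_sum fun y _ => key y).trans ?_
      rw [Finset.sum_add_distrib, weight_cons_inr,
        Equiv.sum_comp (rootPerm w) (fun y => if y = m.first 0 then f b else 0)]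
      simpa using ih

theorem admissible_sectionWord (hom : HomFamily m B) {A' : Subgroup (Equiv.Perm (m.Letter 1))}
    (hA' : ∀ j b, hom 0 j b ∈ A') (y : m.Letter 0) (w : SpinalWord m B) :
    Admissible (m := m.shift) A' (sectionWord hom y w) := by
  induction w with
  | nil => exact admissible_nil
  | cons x w ih =>
    rcases x with a | b
    · exact ih
    · by_cases h : rootPerm w y = m.last 0
      · simpa [sectionWord, h] using ih
      · simpa [sectionWord, h] using ⟨hA' _ _, ih⟩

/-- Merging adjacent directed letters bounds their number by that of the nontrivial rooted
letters, plus one. -/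
theorem exists_reduced (hom : HomFamily m B) {A : Subgroup (Equiv.Perm (m.Letter 0))}
    (w : SpinalWord m B) (hw : Admissible A w) :
    ∃ v : SpinalWord m B, Admissible A v ∧ toAut hom v = toAut hom w ∧
      weight (fun _ => 1) v ≤ weight (fun _ => 1) w ∧
      weight (fun _ => 1) v ≤ rootCount w + 1 := by
  classical
  -- The strengthened claim keeps a pending rooted letter `a` in front. Either the bound holds
  -- without the extra one, so a directed letter can still be added, or `a = 1` and `v` starts with
  -- a directed letter, so the next directed letter merges with it. A nontrivial rooted letter
  -- restores the first case.
  suffices H : ∃ (a : Equiv.Perm (m.Letter 0)) (v : SpinalWord m B), a ∈ A ∧ Admissible A v ∧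
      toAut hom (Sum.inl a :: v) = toAut hom w ∧
      weight (fun _ => 1) v ≤ weight (fun _ => 1) w ∧ weight (fun _ => 1) v ≤ rootCount w + 1 ∧
      (weight (fun _ => 1) v ≤ rootCount w ∨ a = 1 ∧ ∃ b u, v = Sum.inr b :: u) by
    obtain ⟨a, v, ha, hv, e, h1, h2, -⟩ := H
    exact ⟨Sum.inl a :: v, admissible_cons_inl.2 ⟨ha, hv⟩, e, by simpa using h1, by simpa using h2⟩
  induction w with
  | nil => exact ⟨1, [], A.one_mem, admissible_nil, by simp [rootedAut_one], by simp⟩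
  | cons x w ih =>
    rcases x with c | c
    · obtain ⟨hc, hw⟩ := admissible_cons_inl.1 hw
      obtain ⟨a, v, ha, hv, e, h1, h2, h3⟩ := ih hw
      refine ⟨c * a, v, A.mul_mem hc ha, hv, ?_, by simpa using h1, ?_, ?_⟩
      · rw [toAut_cons_inl] at e ⊢
        rw [toAut_cons_inl, ← e, rootedAut_mul, mul_assoc]
      · rw [rootCount_cons_inl]; omega
      · by_cases h : c = 1
        · subst h
          simpa using h3
        · left
          simp only [rootCount_cons_inl, h, if_false]
          omega
    · obtain ⟨a, v, ha, hv, e, h1, h2, h3⟩ := ih (admissible_cons_inr.1 hw)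
      rcases h3 with h3 | ⟨rfl, b, u, rfl⟩
      · refine ⟨1, Sum.inr c :: Sum.inl a :: v, A.one_mem, ?_, ?_, ?_, ?_, Or.inr ⟨rfl, _, _, rfl⟩⟩
        · simpa using ⟨ha, hv⟩
        · rw [toAut_cons_inl, toAut_cons_inr, e, toAut_cons_inr, rootedAut_one, one_mul]
        · simpa using h1
        · simp only [weight_cons_inr, weight_cons_inl, rootCount_cons_inr]; omega
      · refine ⟨1, Sum.inr (c * b) :: u, A.one_mem, ?_, ?_, ?_, ?_, Or.inr ⟨rfl, _, _, rfl⟩⟩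
        · simpa using hv
        · rw [toAut_cons_inr, ← e]
          simp [rootedAut_one, directedAut_mul, mul_assoc]
        · simp only [weight_cons_inr] at h1 ⊢; omega
        · simpa using h2

end SpinalWord

/-! ### Summability over tuples and over words. -/

/-- A finite set of tuples lies in a box, over which the sum of products factors. -/
theorem summable_prod_pi {ι α : Type*} [Fintype ι] {u : α → ℝ} (hu : Summable u)
    (h0 : ∀ x, 0 ≤ u x) : Summable fun x : ι → α => ∏ i, u (x i) := by
  classical
  refine summable_of_sum_le (c := ∏ _i : ι, ∑' x, u x)
    (fun x => Finset.prod_nonneg fun i _ => h0 _) fun T => ?_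
  have hsub : T ⊆ Fintype.piFinset fun i => T.image (· i) := fun x hx =>
    Fintype.mem_piFinset.2 fun i => Finset.mem_image_of_mem _ hx
  refine (Finset.sum_le_sum_of_subset_of_nonneg hsub
    fun x _ _ => Finset.prod_nonneg fun i _ => h0 _).trans ?_
  rw [← Finset.prod_univ_sum]
  exact Finset.prod_le_prod (fun i _ => Finset.sum_nonneg fun x _ => h0 x)
    fun i _ => hu.sum_le_tsum _ fun x _ => h0 x

/-- Grouping lists by length gives a geometric series of ratio `Nat.card α * x`. -/
theorem summable_pow_length {α : Type*} [Finite α] {x : ℝ} (h0 : 0 ≤ x)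
    (h1 : Nat.card α * x < 1) : Summable fun l : List α => x ^ l.length := by
  have := Fintype.ofFinite α
  rw [← List.equivSigmaTuple.symm.summable_iff, summable_sigma_of_nonneg]
  · refine ⟨fun n => Summable.of_finite, ?_⟩
    have : (fun n => ∑' f : Fin n → α,
        ((fun l : List α => x ^ l.length) ∘ List.equivSigmaTuple.symm) ⟨n, f⟩) =
        fun n => ((Nat.card α : ℝ) * x) ^ n := by
      funext n
      simp [tsum_fintype, List.equivSigmaTuple, mul_pow]
    rw [this]
    exact summable_geometric_of_lt_one (by positivity) h1
  · intro p
    exact pow_nonneg h0 _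

/-! ### Weighted norms on the group. -/

namespace DefiningTriple

open SpinalWord

variable {m : BranchingSeq} {B : Type*} [Group B]

theorem mem_group_iff (ω : DefiningTriple m B) {g : TreeAut m} :
    g ∈ ω.group ↔ ∃ w : SpinalWord m B, Admissible ω.rootPart w ∧ toAut ω.hom w = g := by
  constructor
  · intro hg
    have hmul : ∀ {x y : TreeAut m},
        (∃ w : SpinalWord m B, Admissible ω.rootPart w ∧ toAut ω.hom w = x) →
        (∃ w : SpinalWord m B, Admissible ω.rootPart w ∧ toAut ω.hom w = y) →
        ∃ w : SpinalWord m B, Admissible ω.rootPart w ∧ toAut ω.hom w = x * y := by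
      rintro x y ⟨v, hv, rfl⟩ ⟨w, hw, rfl⟩
      exact ⟨v ++ w, hv.append hw, toAut_append _ _ _⟩
    induction hg using Subgroup.closure_induction with
    | mem x hx =>
      rcases hx with ⟨a, ha, rfl⟩ | ⟨b, rfl⟩
      · exact ⟨[Sum.inl a], admissible_cons_inl.2 ⟨ha, admissible_nil⟩, by simp⟩
      · exact ⟨[Sum.inr b], admissible_cons_inr.2 admissible_nil, by simp⟩
    | one => exact ⟨[], admissible_nil, rfl⟩
    | mul x y _ _ hx hy => exact hmul hx hy
    | inv x hx' hx =>
      clear hx'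
      obtain ⟨w, hw, rfl⟩ := hx
      induction w with
      | nil => exact ⟨[], admissible_nil, by simp⟩
      | cons x w ih =>
        rcases x with a | b
        · obtain ⟨ha, hw⟩ := admissible_cons_inl.1 hw
          rw [toAut_cons_inl, mul_inv_rev]
          refine hmul (ih hw) ⟨[Sum.inl a⁻¹], ?_, by simp [rootedAut_inv]⟩
          exact admissible_cons_inl.2 ⟨inv_mem ha, admissible_nil⟩
        · rw [toAut_cons_inr, mul_inv_rev]
          refine hmul (ih (admissible_cons_inr.1 hw)) ⟨[Sum.inr b⁻¹], ?_, by simp [directedAut_inv]⟩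
          exact admissible_cons_inr.2 admissible_nil
  · rintro ⟨w, hw, rfl⟩
    induction w with
    | nil => exact one_mem _
    | cons x w ih =>
      rcases x with a | b
      · obtain ⟨ha, hw⟩ := admissible_cons_inl.1 hw
        rw [toAut_cons_inl]
        exact mul_mem (Subgroup.subset_closure (Or.inl ⟨a, ha, rfl⟩)) (ih hw)
      · rw [toAut_cons_inr]
        exact mul_mem (Subgroup.subset_closure (Or.inr ⟨b, rfl⟩)) (ih (admissible_cons_inr.1 hw))

/-- The least weight of a word representing `g`. -/
noncomputable def weightNorm (ω : DefiningTriple m B) (f : B → ℕ) (g : TreeAut m) : ℕ :=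
  sInf {k | ∃ w : SpinalWord m B, Admissible ω.rootPart w ∧ toAut ω.hom w = g ∧ weight f w = k}

theorem weightNorm_toAut_le (ω : DefiningTriple m B) (f : B → ℕ) {w : SpinalWord m B}
    (hw : Admissible ω.rootPart w) : ω.weightNorm f (toAut ω.hom w) ≤ weight f w :=
  Nat.sInf_le ⟨w, hw, rfl, rfl⟩

theorem exists_weight_eq_weightNorm (ω : DefiningTriple m B) (f : B → ℕ) {g : TreeAut m}
    (hg : g ∈ ω.group) : ∃ w : SpinalWord m B, Admissible ω.rootPart w ∧ toAut ω.hom w = g ∧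
      weight f w = ω.weightNorm f g := by
  obtain ⟨w, hw, rfl⟩ := ω.mem_group_iff.1 hg
  exact Nat.sInf_mem (s := {k | ∃ w' : SpinalWord m B, Admissible ω.rootPart w' ∧
    toAut ω.hom w' = toAut ω.hom w ∧ weight f w' = k}) ⟨_, w, hw, rfl, rfl⟩

theorem weightNorm_mul_le (ω : DefiningTriple m B) (f : B → ℕ) {g h : TreeAut m}
    (hg : g ∈ ω.group) (hh : h ∈ ω.group) :
    ω.weightNorm f (g * h) ≤ ω.weightNorm f g + ω.weightNorm f h := by
  obtain ⟨v, hv, rfl, ev⟩ := ω.exists_weight_eq_weightNorm f hg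
  obtain ⟨w, hw, rfl, ew⟩ := ω.exists_weight_eq_weightNorm f hh
  rw [← ev, ← ew, ← toAut_append, ← weight_append]
  exact ω.weightNorm_toAut_le f (hv.append hw)

theorem weightNorm_one (ω : DefiningTriple m B) (f : B → ℕ) : ω.weightNorm f 1 = 0 :=
  Nat.le_zero.1 (ω.weightNorm_toAut_le f (w := []) admissible_nil)

/-- The triple `σω` obtained by deleting the first level. -/
def shift (ω : DefiningTriple m B) : DefiningTriple m.shift B where
  rootPart := ω.shiftedRootPart 1
  hom := ω.hom.shift

theorem hom_mem_shiftedRootPart (ω : DefiningTriple m B) (j : m.NonLast 0) (b : B) :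
    ω.hom 0 j b ∈ ω.shiftedRootPart 1 :=
  (le_iSup (fun j => (ω.hom 0 j).range) j) ⟨b, rfl⟩

/-! ### Transfer of convergence between a triple and its shift. -/

/-- Convergence of the generating function of a weighted norm at `exp (-t)`. -/
def NormSummable (ω : DefiningTriple m B) (f : B → ℕ) (t : ℝ) : Prop :=
  Summable fun g : ω.group => Real.exp (-(t * ω.weightNorm f g))

/-- The series is dominated, along the injection sending `g` to its root permutation and sections,
by a finite sum over permutations times a product of copies of the series of the shifted triple. -/
theorem normSummable_of_sections (ω : DefiningTriple m B) {f f' : B → ℕ} {k C : ℕ} {t : ℝ}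
    (ht : 0 ≤ t)
    (hsec : ∀ g ∈ ω.group, ∃ (σ : Equiv.Perm (m.Letter 0)) (h : m.Letter 0 → TreeAut m.shift),
      g.HasSections σ h ∧ (∀ y, h y ∈ ω.shift.group) ∧
        k * ∑ y, ω.shift.weightNorm f' (h y) ≤ ω.weightNorm f g + C)
    (hs : ω.shift.NormSummable f' (k * t)) : ω.NormSummable f t := by
  choose! σ h hgh hmem hle using hsec
  let φ : ω.group → Equiv.Perm (m.Letter 0) × (m.Letter 0 → ω.shift.group) :=
    fun g => (σ g, fun y => ⟨h g y, hmem g g.2 y⟩)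
  have hφ : Function.Injective φ := by
    intro g g' e
    have e1 : σ g = σ g' := congrArg Prod.fst e
    have e2 : h g = h g' := by
      funext y
      exact congrArg Subtype.val (congrFun (congrArg Prod.snd e) y)
    apply Subtype.ext
    have h1 := hgh g g.2
    rw [e1, e2] at h1
    exact h1.ext (hgh g' g'.2)
  -- The factor `exp (t * C)` carried by the permutation absorbs the additive loss `C`.
  have hsum := (Summable.of_finite (f := fun _ : Equiv.Perm (m.Letter 0) => Real.exp (t * C))
    ).mul_of_nonneg (summable_prod_pi (ι := m.Letter 0) hs fun _ => (Real.exp_pos _).le)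
      (fun _ => (Real.exp_pos _).le) (fun _ => Finset.prod_nonneg fun _ _ => (Real.exp_pos _).le)
  refine Summable.of_nonneg_of_le (fun _ => (Real.exp_pos _).le) (fun g => ?_)
    (hsum.comp_injective hφ)
  simp only [Function.comp, φ]
  rw [← Real.exp_sum, ← Real.exp_add, Real.exp_le_exp]
  have := hle g g.2
  have h2 : (k : ℝ) * ∑ y, (ω.shift.weightNorm f' (h g y) : ℝ) ≤ ω.weightNorm f g + C := by
    exact_mod_cast this
  have h3 := mul_le_mul_of_nonneg_left h2 ht
  rw [Finset.sum_neg_distrib, ← Finset.mul_sum]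
  linarith

/-- Passing to sections preserves the total weight, so any weight `f` descends at the same `t`,
whether or not a directed letter is killed. -/
theorem NormSummable.of_shift (ω : DefiningTriple m B) {f : B → ℕ} {t : ℝ} (ht : 0 ≤ t)
    (hs : ω.shift.NormSummable f t) : ω.NormSummable f t := by
  refine ω.normSummable_of_sections (f' := f) (k := 1) (C := 0) ht (fun g hg => ?_) (by simpa)
  obtain ⟨w, hw, rfl, e⟩ := ω.exists_weight_eq_weightNorm f hg
  have hadm := fun y => admissible_sectionWord ω.hom ω.hom_mem_shiftedRootPart y w
  refine ⟨_, _, hasSections_toAut ω.hom w, fun y => ω.shift.mem_group_iff.2 ⟨_, hadm y, rfl⟩, ?_⟩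
  rw [one_mul, add_zero, ← e, ← sum_weight_sectionWord ω.hom f w]
  exact Finset.sum_le_sum fun y _ => ω.shift.weightNorm_toAut_le f (hadm y)

open Classical in
/-- The weight which is `1` at `b` and `2` elsewhere. -/
noncomputable def favor (b : B) (c : B) : ℕ := if c = b then 1 else 2

theorem NormSummable.favor_of_shift (ω : DefiningTriple m B) {b : B} {t : ℝ} (ht : 0 ≤ t)
    (htriv : ∀ j, j ≠ m.firstIdx 0 → ω.hom 0 j = 1) (hb : ω.hom 0 (m.firstIdx 0) b = 1)
    (hs : ω.shift.NormSummable (fun _ => 1) (2 * t)) : ω.NormSummable (favor b) t := by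
  classical
  -- The constant `C` collects the extra one from `exists_reduced` over the `m.idx 0` sections.
  refine ω.normSummable_of_sections (f' := fun _ => 1) (k := 2) (C := m.idx 0) ht
    (fun g hg => ?_) (by exact_mod_cast hs)
  obtain ⟨w, hw, rfl, e⟩ := ω.exists_weight_eq_weightNorm (favor b) hg
  have hadm := fun y => admissible_sectionWord ω.hom ω.hom_mem_shiftedRootPart y w
  refine ⟨_, _, hasSections_toAut ω.hom w, fun y => ω.shift.mem_group_iff.2 ⟨_, hadm y, rfl⟩, ?_⟩
  have hy : ∀ y, 2 * ω.shift.weightNorm (fun _ => 1) (toAut ω.hom.shift (sectionWord ω.hom y w)) ≤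
      weight (fun _ => 1) (sectionWord ω.hom y w) + rootCount (sectionWord ω.hom y w) + 1 := by
    intro y
    obtain ⟨v, hv, hvw, h1, h2⟩ := exists_reduced ω.hom.shift _ (hadm y)
    have := ω.shift.weightNorm_toAut_le (fun _ => 1) hv
    rw [show toAut ω.shift.hom v = _ from hvw] at this
    omega
  rw [Finset.mul_sum, ← e]
  refine (Finset.sum_le_sum fun y _ => hy y).trans ?_
  rw [Finset.sum_add_distrib, Finset.sum_add_distrib, sum_weight_sectionWord]
  -- Weight 0 at `b` is allowed because `b` acts trivially here. Adding the count of all directed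
  -- letters gives exactly `favor b`.
  have h1 := sum_rootCount_sectionWord_le ω.hom htriv (fun c => if c = b then 0 else 1)
    (fun c hc => by
      have : c ≠ b := fun h => hc (h ▸ hb)
      simp [this]) w
  have h2 : weight (favor b) w = weight (fun _ => 1) w + weight (fun c => if c = b then 0 else 1) w := by
    clear e hadm h1 hy hw hg
    induction w with
    | nil => rfl
    | cons x w ih =>
      rcases x with a | c
      · simpa using ih
      · simp only [weight_cons_inr, ih, favor]
        split_ifs <;> omega
  simp only [Finset.sum_const, Finset.card_univ, Fintype.card_fin, smul_eq_mul, mul_one]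
  omega

/-- Each directed letter `c` counts 1 for `b = c` and 2 for every other `b`. -/
theorem sum_weight_favor {m : BranchingSeq} {B : Type*} [Fintype B] (w : SpinalWord m B) :
    ∑ b, weight (favor b) w = (2 * Fintype.card B - 1) * weight (fun _ => 1) w := by
  classical
  induction w with
  | nil => simp
  | cons x w ih =>
    rcases x with a | c
    · simpa using ih
    · have : ∑ b : B, favor b c = 2 * Fintype.card B - 1 := by
        have h1 : ∑ b : B, (favor b c + if c = b then 1 else 0) = 2 * Fintype.card B := by
          rw [Finset.sum_congr rfl (g := fun _ => 2)]
          · simp [mul_comm]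
          · intro b _
            simp only [favor]
            split_ifs <;> rfl
        rw [Finset.sum_add_distrib] at h1
        simp at h1
        omega
      simp only [weight_cons_inr, Finset.sum_add_distrib, ih, this]
      ring

/-- For each `g` some `b` has `favor b` norm at most the average `(2N-1)/N` times the norm. The term
of `g` is therefore dominated by a term of one of the finitely many series indexed by `b`. -/
theorem NormSummable.of_favor [Fintype B] (ω : DefiningTriple m B) {t : ℝ} (ht : 0 ≤ t)
    (hs : ∀ b, ω.NormSummable (favor b) (t * (Fintype.card B / (2 * Fintype.card B - 1)))) :
    ω.NormSummable (fun _ => 1) t := by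
  have hN : (1 : ℝ) ≤ Fintype.card B := by exact_mod_cast Fintype.card_pos
  refine Summable.of_nonneg_of_le (fun _ => (Real.exp_pos _).le) (fun g => ?_)
    (summable_sum (s := Finset.univ) fun b _ => hs b)
  obtain ⟨w, hw, e1, e⟩ := ω.exists_weight_eq_weightNorm (fun _ => 1) g.2
  -- Multiplying by the cardinality keeps the averaging argument in the natural numbers.
  have h1 : ∑ b, (Fintype.card B * weight (favor b) w) ≤
      ∑ _b : B, (2 * Fintype.card B - 1) * weight (fun _ => 1) w := by
    rw [← Finset.mul_sum, sum_weight_favor]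
    simp
  obtain ⟨b, -, hb⟩ := Finset.exists_le_of_sum_le Finset.univ_nonempty h1
  have h2 := ω.weightNorm_toAut_le (favor b) hw
  rw [e1] at h2
  rw [e] at hb
  have h3 := (Nat.mul_le_mul_left (Fintype.card B) h2).trans hb
  have h4 : (Fintype.card B : ℝ) * ω.weightNorm (favor b) g ≤
      (2 * Fintype.card B - 1) * ω.weightNorm (fun _ => 1) g := by
    have h5 : ((2 * Fintype.card B - 1 : ℕ) : ℝ) = 2 * Fintype.card B - 1 := by
      rw [Nat.cast_sub (by have := Fintype.card_pos (α := B); omega)]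
      simp
    rw [← h5]
    exact_mod_cast h3
  refine le_trans ?_ (Finset.single_le_sum (f := fun b => Real.exp
    (-(t * (Fintype.card B / (2 * Fintype.card B - 1)) * ω.weightNorm (favor b) g)))
    (fun _ _ => (Real.exp_pos _).le) (Finset.mem_univ b))
  rw [Real.exp_le_exp, neg_le_neg_iff, mul_assoc]
  refine mul_le_mul_of_nonneg_left ?_ ht
  rw [div_mul_eq_mul_div, div_le_iff₀ (by linarith)]
  linarith

theorem exists_list_of_admissible (ω : DefiningTriple m B) {w : SpinalWord m B}
    (hw : Admissible ω.rootPart w) : ∃ (a : ω.rootPart) (l : List (B × ω.rootPart)),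
      l.length = weight (fun _ => 1) w ∧
      toAut ω.hom w = rootedAut a.1 * (l.map fun p => directedAut ω.hom p.1 * rootedAut p.2.1).prod := by
  induction w with
  | nil => exact ⟨1, [], rfl, by simp [rootedAut_one]⟩
  | cons x w ih =>
    rcases x with c | b
    · obtain ⟨hc, hw⟩ := admissible_cons_inl.1 hw
      obtain ⟨a, l, hl, e⟩ := ih hw
      exact ⟨⟨c, hc⟩ * a, l, by simpa using hl, by simp [e, rootedAut_mul, mul_assoc]⟩
    · obtain ⟨a, l, hl, e⟩ := ih (admissible_cons_inr.1 hw)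
      exact ⟨1, (b, a) :: l, by simp [hl, add_comm], by simp [e, rootedAut_one, mul_assoc]⟩

/-- A minimal word is a rooted letter followed by syllables in `B × ω.rootPart`, as many as the
norm. Elements thus inject into such data, and a geometric series dominates. -/
theorem normSummable_of_card_mul_exp_lt_one [Finite B] (ω : DefiningTriple m B) {t : ℝ}
    (h : Nat.card B * Nat.card ω.rootPart * Real.exp (-t) < 1) :
    ω.NormSummable (fun _ => 1) t := by
  have hex : ∀ g : ω.group, ∃ p : ω.rootPart × List (B × ω.rootPart),
      p.2.length = ω.weightNorm (fun _ => 1) g ∧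
      g.1 = rootedAut p.1.1 *
        (p.2.map fun p => directedAut ω.hom p.1 * rootedAut p.2.1).prod := by
    intro g
    obtain ⟨w, hw, e1, e⟩ := ω.exists_weight_eq_weightNorm (fun _ => 1) g.2
    obtain ⟨a, l, hl, h⟩ := ω.exists_list_of_admissible hw
    exact ⟨(a, l), hl.trans e, e1.symm.trans h⟩
  choose φ hlen hφ using hex
  have hinj : Function.Injective φ := fun g g' e => Subtype.ext (by rw [hφ g, hφ g', e])
  have hsum := (Summable.of_finite (f := fun _ : ω.rootPart => (1 : ℝ))).mul_of_nonneg
    (summable_pow_length (α := B × ω.rootPart) (Real.exp_pos (-t)).le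
      (by rw [Nat.card_prod]; exact_mod_cast h))
    (fun _ => zero_le_one) (fun _ => pow_nonneg (Real.exp_pos _).le _)
  refine (hsum.comp_injective hinj).congr fun g => ?_
  simp only [Function.comp, hlen, one_mul]
  rw [← Real.exp_nat_mul]
  congr 1
  ring

/-! ### Lowering the exponent to every positive `t`. -/

/-- The properties of a GG triple used for its growth, with a bound `c` on the root groups. -/
structure IsCoveringBy (ω : DefiningTriple m B) (c : ℕ) : Prop where
  card_rootPart_le : Nat.card ω.rootPart ≤ c
  hom_eq_one : ∀ (i : ℕ) (j : m.NonLast i), j ≠ m.firstIdx i → ω.hom i j = 1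
  exists_hom_eq_one : ∀ (b : B) (r : ℕ), ∃ i ≥ r, ω.hom i (m.firstIdx i) b = 1

theorem IsGG.isCoveringBy {ω : DefiningTriple m B} (hω : ω.IsGG) {c : ℕ}
    (hc : Nat.card ω.rootPart ≤ c) : ω.IsCoveringBy c where
  card_rootPart_le := hc
  hom_eq_one := hω.hom_eq_one
  exists_hom_eq_one b r := by
    have hb : b ∈ ⋃ i ≥ r, ((ω.hom i (m.firstIdx i)).ker : Set B) := by
      rw [hω.strong_covering r]
      trivial
    simpa using hb

/-- The shifted root group is a quotient of `B`, the only possibly nontrivial homomorphism being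
that of the first letter. One bound `c ≥ |B|` therefore serves every later level. -/
theorem IsCoveringBy.shift [Finite B] {ω : DefiningTriple m B} {c : ℕ} (hω : ω.IsCoveringBy c)
    (hc : Nat.card B ≤ c) : ω.shift.IsCoveringBy c where
  card_rootPart_le := by
    have h : ω.shift.rootPart ≤ (ω.hom 0 (m.firstIdx 0)).range := by
      refine iSup_le fun j => ?_
      by_cases hj : j = m.firstIdx 0
      · rw [hj]
      · rw [hω.hom_eq_one 0 j hj]
        rintro _ ⟨b, rfl⟩
        exact one_mem _
    refine le_trans ?_ hc
    refine (Subgroup.card_le_of_le h).trans ?_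
    exact Nat.card_le_card_of_surjective _ (ω.hom 0 (m.firstIdx 0)).rangeRestrict_surjective
  hom_eq_one i j hj := hω.hom_eq_one (i + 1) j hj
  exists_hom_eq_one b r := by
    obtain ⟨i, hi, h⟩ := hω.exists_hom_eq_one b (r + 1)
    obtain ⟨i, rfl⟩ : ∃ k, i = k + 1 := ⟨i - 1, by omega⟩
    exact ⟨i, by omega, h⟩

theorem IsCoveringBy.normSummable_favor [Finite B] {c : ℕ} (hc : Nat.card B ≤ c) {t : ℝ}
    (ht : 0 ≤ t) (H : ∀ (m : BranchingSeq) (ω : DefiningTriple m B), ω.IsCoveringBy c →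
      ω.NormSummable (fun _ => 1) (2 * t))
    {ω : DefiningTriple m B} (hω : ω.IsCoveringBy c) (b : B) : ω.NormSummable (favor b) t := by
  obtain ⟨i, -, hi⟩ := hω.exists_hom_eq_one b 0
  -- The induction is on a level `i` where `b` is killed: there the contraction applies, and above
  -- it weights descend unchanged.
  induction i generalizing m with
  | zero => exact .favor_of_shift ω ht (hω.hom_eq_one 0) hi (H _ _ (hω.shift hc))
  | succ i ih => exact .of_shift ω ht (ih (hω.shift hc) hi)

theorem IsCoveringBy.normSummable [Finite B] {c : ℕ} (hc : Nat.card B ≤ c) {t : ℝ} (ht : 0 < t)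
    {ω : DefiningTriple m B} (hω : ω.IsCoveringBy c) : ω.NormSummable (fun _ => 1) t := by
  have := Fintype.ofFinite B
  have hN : (1 : ℝ) ≤ Fintype.card B := by exact_mod_cast Fintype.card_pos
  set q : ℝ := Fintype.card B / (2 * Fintype.card B - 1) with hq
  have hq1 : 1 < 2 * q := by
    rw [hq, mul_div_assoc', lt_div_iff₀ (by linarith)]
    linarith
  have hq0 : 0 < q := by linarith
  have hexp : Filter.Tendsto (fun s : ℝ => (Nat.card B * c : ℝ) * Real.exp (-s)) Filter.atTop
      (nhds 0) := by
    simpa using Real.tendsto_exp_neg_atTop_nhds_zero.const_mul (Nat.card B * c : ℝ)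
  have hpow : Filter.Tendsto (fun n : ℕ => (2 * q) ^ n * t) Filter.atTop Filter.atTop :=
    (tendsto_pow_atTop_atTop_of_one_lt hq1).atTop_mul_const ht
  -- This `n` depends only on `B`, `c` and `t`, so the starting exponent is uniform over all
  -- triples. This matters because the depth of descent varies with `b`.
  obtain ⟨n, hn⟩ := ((hexp.comp hpow).eventually_lt_const zero_lt_one).exists
  have base : ∀ (m : BranchingSeq) (ω : DefiningTriple m B), ω.IsCoveringBy c →
      ω.NormSummable (fun _ => 1) ((2 * q) ^ n * t) := by
    intro m ω hω
    refine ω.normSummable_of_card_mul_exp_lt_one (lt_of_le_of_lt ?_ hn)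
    have : (Nat.card ω.rootPart : ℝ) ≤ c := by exact_mod_cast hω.card_rootPart_le
    simp only [Function.comp]
    gcongr
  clear hn
  induction n generalizing m ω with
  | zero => simpa using base m ω hω
  -- `ih` needs convergence at `(2 * q) ^ n * t` for every triple: averaging multiplies this
  -- exponent by `q`, contraction by 2, which leads to `base` at `n + 1`.
  | succ n ih =>
    refine ih hω fun m ω hω => .of_favor ω (by positivity) fun b => ?_
    refine hω.normSummable_favor hc (by positivity) (fun m ω hω => ?_) b
    convert base m ω hω using 1
    rw [← hq]
    ring

end DefiningTriple

/-! ### From convergence to word growth. -/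

theorem wordBall_zero {G : Type*} [Group G] (S : Set G) : wordBall S 0 = {1} := by
  ext g
  constructor
  · rintro ⟨l, -, hl, rfl⟩
    rw [List.length_eq_zero_iff.1 (Nat.le_zero.1 hl)]
    rfl
  · rintro rfl
    exact ⟨[], by simp, le_rfl, rfl⟩

namespace DefiningTriple

variable {m : BranchingSeq} {B : Type*} [Group B]

theorem fg_group [Finite B] (ω : DefiningTriple m B) : Group.FG ω.group := by
  rw [Group.fg_iff_subgroup_fg, Subgroup.fg_iff]
  exact ⟨_, rfl, ((Set.toFinite _).image _).union (Set.finite_range _)⟩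

/-- By subadditivity, the largest norm `D` of a generator bounds the norm linearly in word length.
-/
theorem exists_weightNorm_le_mul (ω : DefiningTriple m B) (f : B → ℕ) {S : Set ω.group}
    (hS : S.Finite) : ∃ D : ℕ, ∀ n, ∀ g ∈ wordBall S n, ω.weightNorm f g ≤ D * n := by
  obtain ⟨D, hD⟩ := (hS.image fun g : ω.group => ω.weightNorm f g).bddAbove
  refine ⟨D, ?_⟩
  rintro n _ ⟨l, hl, hn, rfl⟩
  refine le_trans ?_ (Nat.mul_le_mul_left D hn)
  clear hn
  induction l with
  | nil => simp [weightNorm_one]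
  | cons s l ih =>
    have h1 : ω.weightNorm f s ≤ D := hD ⟨s, hl s (by simp), rfl⟩
    have h2 := ih fun s hs => hl s (by simp [hs])
    have h3 := ω.weightNorm_mul_le f s.2 (l.prod : ω.group).2
    rw [List.prod_cons, List.length_cons, mul_add, mul_one, Subgroup.coe_mul]
    omega

/-- A convergent generating function bounds the word growth. -/
theorem NormSummable.wordGrowth_le {ω : DefiningTriple m B} {f : B → ℕ} {t : ℝ} (ht : 0 ≤ t)
    (hs : ω.NormSummable f t) {S : Set ω.group} {D : ℕ}
    (hD : ∀ n, ∀ g ∈ wordBall S n, ω.weightNorm f g ≤ D * n) (n : ℕ) :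
    (wordGrowth S n : ℝ) ≤
      (∑' g : ω.group, Real.exp (-(t * ω.weightNorm f g))) * Real.exp (t * (D * n)) := by
  have hpos : 0 ≤ ∑' g : ω.group, Real.exp (-(t * ω.weightNorm f g)) :=
    tsum_nonneg fun _ => (Real.exp_pos _).le
  rcases Set.finite_or_infinite (wordBall S n) with hfin | hinf
  · rw [wordGrowth, Set.ncard_eq_toFinset_card _ hfin, ← div_le_iff₀ (Real.exp_pos _)]
    refine le_trans ?_ (hs.sum_le_tsum hfin.toFinset fun _ _ => (Real.exp_pos _).le)
    rw [div_eq_mul_inv, ← Real.exp_neg, ← nsmul_eq_mul]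
    refine Finset.card_nsmul_le_sum _ _ _ fun g hg => ?_
    rw [Real.exp_le_exp, neg_le_neg_iff]
    refine mul_le_mul_of_nonneg_left ?_ ht
    exact_mod_cast hD n g (hfin.mem_toFinset.1 hg)
  -- An infinite ball has `ncard` equal to 0.
  · rw [wordGrowth, hinf.ncard]
    simpa using mul_nonneg hpos (Real.exp_pos _).le

end DefiningTriple

theorem mainTheorem3 (m : BranchingSeq) {B : Type*} [Group B] [Finite B]
    (ω : DefiningTriple m B) (hω : ω.IsGG) :
    HasSubexponentialGrowth ω.group := by
  refine ⟨ω.fg_group, fun S hS _ => ?_⟩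
  obtain ⟨D, hD⟩ := ω.exists_weightNorm_le_mul (fun _ => 1) hS
  have hsum : ∀ t : ℝ, 0 < t → ω.NormSummable (fun _ => 1) t := fun t ht =>
    (hω.isCoveringBy (le_max_left _ (Nat.card B))).normSummable (le_max_right _ _) ht
  constructor
  · have hb := (hsum 1 one_pos).wordGrowth_le zero_le_one hD
    set F : ℝ := ∑' g : ω.group, Real.exp (-(1 * ω.weightNorm (fun _ => 1) g))
    obtain ⟨K, hK⟩ := exists_nat_ge F
    -- Since `F ≤ K`, the constant factor is at most `exp (K * n)` once `n ≥ 1`. At `n = 0` the ball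
    -- is a single point.
    refine ⟨K + D, fun n => ?_⟩
    dsimp only
    rcases Nat.eq_zero_or_pos n with rfl | hn
    · simp [wordGrowth, wordBall_zero]
    · have hn' : (1 : ℝ) ≤ n := by exact_mod_cast hn
      calc (wordGrowth S n : ℝ) ≤ F * Real.exp (1 * (D * n)) := hb n
        _ ≤ Real.exp (K * n) * Real.exp (1 * (D * n)) := by
          refine mul_le_mul_of_nonneg_right ?_ (Real.exp_pos _).le
          have h1 : (K : ℝ) ≤ K * n := le_mul_of_one_le_right (Nat.cast_nonneg _) hn'
          linarith [Real.add_one_le_exp ((K : ℝ) * n)]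
        _ = Real.exp (((K + D) * n : ℕ) : ℝ) := by
          rw [← Real.exp_add]
          congr 1
          push_cast
          ring
  · rintro ⟨C, hC⟩
    -- This choice makes `t * D * C ≤ 1/2`, so `exp n ≤ F * exp (n / 2)`, which fails for `n > 2 *
    -- F`.
    set t : ℝ := 1 / (2 * (D * C + 1)) with ht
    have ht0 : 0 < t := by positivity
    have hb := (hsum t ht0).wordGrowth_le ht0.le hD
    set F : ℝ := ∑' g : ω.group, Real.exp (-(t * ω.weightNorm (fun _ => 1) g))
    have htC : t * (D * C) ≤ 1 / 2 := by
      rw [ht, div_mul_eq_mul_div, div_le_div_iff₀ (by positivity) two_pos]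
      linarith
    obtain ⟨n, hn⟩ := exists_nat_gt (2 * F)
    have h1 : Real.exp n ≤ F * Real.exp (t * (D * (C * n : ℕ))) := (hC n).trans (hb _)
    have h2 : t * (D * (C * n : ℕ)) ≤ n / 2 := by
      have := mul_le_mul_of_nonneg_right htC (Nat.cast_nonneg n : (0 : ℝ) ≤ n)
      push_cast
      linarith
    have hF : 0 ≤ F := tsum_nonneg fun _ => (Real.exp_pos _).le
    have h3 := h1.trans (mul_le_mul_of_nonneg_left (Real.exp_le_exp.2 h2) hF)
    rw [← add_halves (n : ℝ), Real.exp_add, add_halves] at h3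
    have h4 := le_of_mul_le_mul_right h3 (Real.exp_pos _)
    linarith [Real.add_one_le_exp ((n : ℝ) / 2)]
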